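/- Let $\mathbb{C}[x]\langle\partial,\partial^{-1}\rangle$ be the $\mathbb{C}$-algebra generated by $x,\partial,\partial^{-1}$ with relations $\partial x-x\partial=1$, $\partial\partial^{-1}=\partial^{-1}\partial=1$. On $\mathbb{C}[x]$ put $D=d/dx$ and $L(x^k)=x^{k+1}/(k+1)$. Let $I$ be the ideal of finite-rank operators in $\mathrm{End}_{\mathbb{C}}(\mathbb{C}[x])$, with its usual trace $\mathrm{tr}:I\to\mathbb{C}$, let $\pi:\mathrm{End}_{\mathbb{C}}(\mathbb{C}[x])\to \mathrm{End}_{\mathbb{C}}(\mathbb{C}[x])/I$ be the projection to the Calkin algebra, and let $\theta:\mathbb{C}[x]\langle\partial,\partial^{-1}\rangle\to\mathrm{End}_{\mathbb{C}}(\mathbb{C}[x])/I$ be the algebra homomorphism with $x\mapsto\pi(x\,\cdot)$, $\partial\mapsto \pi(D)$, $\partial^{-1}\mapsto\pi(L)$. Let $\alpha_0:\mathbb{C}[x]\langle\partial,\partial^{-1}\rangle\to\mathrm{End}_{\mathbb{C}}(\mathbb{C}[x])$ be the linear lift of $\theta$ determined by $$\alpha_0\Big(\sum_i a_i\partial^i+\sum_j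 b_j\partial^{-1}c_j\Big)=\sum_i a_iD^i+\sum_j b_jLc_j\qquad(a_i,b_j,c_j\in\mathbb{C}[x]),$$ and let $\sigma_0(P,Q)=\mathrm{tr}\big(\alpha_0([P,Q])-[\alpha_0(P),\alpha_0(Q)]\big)$ be the Calkin cocycle. Let $\sigma_1(P,Q)=\sigma_0(g(P),g(Q))$ be its transport to the Lie algebra $\mathbb{C}[z,z^{-1}][\frac{d}{dz}]$ of differential operators on the circle along the algebra isomorphism $g$ with $g(z)=\partial$, $g(\frac{d}{dz})=-x$. Let $\tau$ be the Kac cocycle on $\mathbb{C}[z,z^{-1}][\frac{d}{dz}]$, with its sign normalised by $\tau(z,z^{-1})=-1$, that is, the bilinear form with $$\tau\Big(f\tfrac{d^n}{dz^n},\,g\tfrac{d^s}{dz^s}\Big)=\frac{n!\,s!}{(n+s+1)!}\,\mathrm{Res}_{z=0}\,f^{(s)}(z)\,g^{(n+1)}(z)\,dz\qquad(f,g\in\mathbb{C}[z,z^{-1}],\ n,s\ge 0).$$ Then $\sigma_1$ is a Lie algebra 2-cocycle, and $\sigma_1=\tau$: $\sigma_1(P,Q)=\tau(P,Q)$ for all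 $P,Q\in\mathbb{C}[z,z^{-1}][\frac{d}{dz}]$. -/

import Mathlib

open Polynomial
open scoped Nat LaurentPolynomial

noncomputable section

namespace CalkinKac

section Calkin

variable (K V : Type*) [Field K] [AddCommGroup V] [Module K V]

/-- The two-sided ideal `I(V)` of `End_K(V)` formed by the linear maps of finite rank. -/
def finiteRankIdeal : Ideal (Module.End K V) where
  carrier := {f | FiniteDimensional K (LinearMap.range f)}
  zero_mem' := by
    change FiniteDimensional K (LinearMap.range (0 : V →ₗ[K] V))
    rw [LinearMap.range_zero]; infer_instance
  add_mem' {f g} hf hg := by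
    have hf' : FiniteDimensional K (LinearMap.range f) := hf
    have hg' : FiniteDimensional K (LinearMap.range g) := hg
    exact Submodule.finiteDimensional_of_le (LinearMap.range_add_le f g)
  smul_mem' c f hf := by
    have hf' : FiniteDimensional K (LinearMap.range f) := hf
    change FiniteDimensional K (LinearMap.range (c ∘ₗ f))
    rw [LinearMap.range_comp]; infer_instance

instance : (finiteRankIdeal K V).IsTwoSided where
  mul_mem_of_left {f} g hf := by
    have hf' : FiniteDimensional K (LinearMap.range f) := hf
    change FiniteDimensional K (LinearMap.range (f ∘ₗ g))
    exact Submodule.finiteDimensional_of_le (LinearMap.range_comp_le_range g f)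

/-- The Calkin algebra `M_K(V) = End_K(V) / I(V)`. -/
abbrev CalkinAlgebra : Type _ := Module.End K V ⧸ finiteRankIdeal K V

variable {K V}

theorem trace_restrict_eq (f : V →ₗ[K] V) (p q : Submodule K V) [FiniteDimensional K q]
    (hpq : p ≤ q) (hf : ∀ x, f x ∈ p) :
    LinearMap.trace K p (f.restrict fun x _ => hf x) =
      LinearMap.trace K q (f.restrict fun x _ => hpq (hf x)) := by
  have h := LinearMap.trace_restrict_eq_of_forall_mem (p.submoduleOf q)
    (f.restrict fun x (_ : x ∈ q) => hpq (hf x)) (fun x => hf x)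
  rw [← h]
  rw [← LinearMap.trace_conj' _ (Submodule.submoduleOfEquivOfLe hpq)]
  rfl

variable (K V) in
/-- The trace `tr : I(V) → K` of an endomorphism of finite rank: the trace of its restriction to
its own (finite-dimensional) range. -/
def finiteRankTrace : finiteRankIdeal K V →ₗ[K] K where
  toFun f := LinearMap.trace K (LinearMap.range f.1)
    (f.1.restrict fun x _ => LinearMap.mem_range_self f.1 x)
  map_add' f g := by
    have hf : FiniteDimensional K (LinearMap.range f.1) := f.2
    have hg : FiniteDimensional K (LinearMap.range g.1) := g.2
    rw [trace_restrict_eq f.1 _ _ (le_sup_left (b := LinearMap.range g.1)) _,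
      trace_restrict_eq g.1 _ _ (le_sup_right (a := LinearMap.range f.1)) _,
      ← map_add]
    exact trace_restrict_eq (f + g).1 _ _ (LinearMap.range_add_le f.1 g.1) _
  map_smul' c f := by
    have hf : FiniteDimensional K (LinearMap.range f.1) := f.2
    have hle : LinearMap.range (c • f).1 ≤ LinearMap.range f.1 := by
      rintro _ ⟨x, rfl⟩
      exact ⟨c • x, by simp⟩
    rw [trace_restrict_eq (c • f).1 _ _ hle _, RingHom.id_apply, ← map_smul]
    rfl

variable {A : Type*} [Ring A] [Algebra K A]

/-- The Calkin cocycle `σ_α(P, Q) = tr(α([P, Q]) - [α(P), α(Q)])` attached to a homomorphism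
`θ` of an algebra into the Calkin algebra and a linear lift `α` of `θ`. -/
def calkinCocycle (θ : A →ₐ[K] CalkinAlgebra K V) (α : A →ₗ[K] Module.End K V)
    (hα : ∀ P, Ideal.Quotient.mk (finiteRankIdeal K V) (α P) = θ P) : A →ₗ[K] A →ₗ[K] K :=
  have hmem (P Q : A) : α ⁅P, Q⁆ - ⁅α P, α Q⁆ ∈ finiteRankIdeal K V := by
    rw [← Ideal.Quotient.eq_zero_iff_mem]
    simp only [map_sub, Ring.lie_def, map_mul, hα, sub_self]
  LinearMap.mk₂ K (fun P Q => finiteRankTrace K V ⟨α ⁅P, Q⁆ - ⁅α P, α Q⁆, hmem P Q⟩)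
    (fun P P' Q => by
      rw [← map_add]; congr 1; ext1; simp [Ring.lie_def, add_mul, mul_add]; abel)
    (fun c P Q => by
      rw [← map_smul]; congr 1; ext1; simp [Ring.lie_def, smul_sub])
    (fun P Q Q' => by
      rw [← map_add]; congr 1; ext1; simp [Ring.lie_def, add_mul, mul_add]; abel)
    (fun c P Q => by
      rw [← map_smul]; congr 1; ext1; simp [Ring.lie_def, smul_sub])

end Calkin

/-- A `K`-valued Lie algebra 2-cocycle (for the trivial module): an alternating bilinear form
satisfying the cocycle identity. -/
def IsLieTwoCocycle {K L : Type*} [Field K] [LieRing L] [LieAlgebra K L]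
    (σ : L →ₗ[K] L →ₗ[K] K) : Prop :=
  (∀ P, σ P P = 0) ∧ ∀ P Q R, σ ⁅P, Q⁆ R + σ ⁅Q, R⁆ P + σ ⁅R, P⁆ Q = 0

/-! ### The algebra `ℂ[x]⟨∂, ∂⁻¹⟩` and its map to the Calkin algebra of `ℂ[x]` -/

inductive PsiGen | x | del | delInv

/-- The relations `∂x - x∂ = 1`, `∂∂⁻¹ = 1`, `∂⁻¹∂ = 1`. -/
inductive PsiRel : FreeAlgebra ℂ PsiGen → FreeAlgebra ℂ PsiGen → Prop
  | weyl : PsiRel (.ι ℂ .del * .ι ℂ .x - .ι ℂ .x * .ι ℂ .del) 1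
  | del_delInv : PsiRel (.ι ℂ .del * .ι ℂ .delInv) 1
  | delInv_del : PsiRel (.ι ℂ .delInv * .ι ℂ .del) 1

/-- The algebra `ℂ[x]⟨∂, ∂⁻¹⟩`, presented by generators and relations.
(For the derivation `d/dx` the relation `∂a - a∂ = a'` for all `a ∈ ℂ[x]` follows from `a = x`.) -/
def PsiDO : Type := RingQuot PsiRel

instance : Ring PsiDO := inferInstanceAs (Ring (RingQuot PsiRel))
instance : Algebra ℂ PsiDO := inferInstanceAs (Algebra ℂ (RingQuot PsiRel))

namespace PsiDO

/-- The quotient map from the free algebra. -/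
def mk : FreeAlgebra ℂ PsiGen →ₐ[ℂ] PsiDO := RingQuot.mkAlgHom ℂ PsiRel

theorem mk_rel {a b : FreeAlgebra ℂ PsiGen} (h : PsiRel a b) : mk a = mk b :=
  RingQuot.mkAlgHom_rel ℂ h

theorem mk_surjective : Function.Surjective mk := RingQuot.mkAlgHom_surjective ℂ PsiRel

def x : PsiDO := mk (.ι ℂ .x)
def del : PsiDO := mk (.ι ℂ .del)
def delInv : PsiDO := mk (.ι ℂ .delInv)

theorem weyl : del * x - x * del = 1 := by
  simpa [x, del, delInv] using mk_rel PsiRel.weyl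

theorem del_delInv : del * delInv = 1 := by
  simpa [x, del, delInv] using mk_rel PsiRel.del_delInv

theorem delInv_del : delInv * del = 1 := by
  simpa [x, del, delInv] using mk_rel PsiRel.delInv_del

/-- The inclusion `ℂ[x] → ℂ[x]⟨∂, ∂⁻¹⟩`. -/
def ofPoly : ℂ[X] →ₐ[ℂ] PsiDO := Polynomial.aeval x

/-- The universal property of the presentation. -/
def lift {B : Type*} [Ring B] [Algebra ℂ B] (u d e : B) (h₁ : d * u - u * d = 1)
    (h₂ : d * e = 1) (h₃ : e * d = 1) : PsiDO →ₐ[ℂ] B :=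
  show RingQuot _ →ₐ[ℂ] B from RingQuot.liftAlgHom ℂ
    ⟨FreeAlgebra.lift ℂ (fun i => match i with | .x => u | .del => d | .delInv => e), by
      rintro _ _ (_ | _ | _) <;> simp [h₁, h₂, h₃]⟩

section
variable {B : Type*} [Ring B] [Algebra ℂ B] {u d e : B} (h₁ : d * u - u * d = 1)
    (h₂ : d * e = 1) (h₃ : e * d = 1)

@[simp] theorem lift_x : lift u d e h₁ h₂ h₃ x = u := by
  exact (RingQuot.liftAlgHom_mkAlgHom_apply ..).trans (by simp)
@[simp] theorem lift_del : lift u d e h₁ h₂ h₃ del = d := by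
  exact (RingQuot.liftAlgHom_mkAlgHom_apply ..).trans (by simp)
@[simp] theorem lift_delInv : lift u d e h₁ h₂ h₃ delInv = e := by
  exact (RingQuot.liftAlgHom_mkAlgHom_apply ..).trans (by simp)

theorem hom_ext {f g : PsiDO →ₐ[ℂ] B} (hx : f x = g x) (hd : f del = g del)
    (he : f delInv = g delInv) : f = g := by
  apply RingQuot.ringQuot_ext'
  apply FreeAlgebra.hom_ext
  funext i
  cases i
  · exact hx
  · exact hd
  · exact he

end

end PsiDO

/-- The operator `D = d/dx` on `ℂ[x]`. -/
def D : Module.End ℂ ℂ[X] := Polynomial.derivative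

/-- The integration operator `L` on `ℂ[x]`, `L(x^k) = x^(k+1)/(k+1)`. -/
def L : Module.End ℂ ℂ[X] :=
  Polynomial.lsum fun k => ((k : ℂ) + 1)⁻¹ • Polynomial.monomial (k + 1)

/-- The operator of multiplication by `a ∈ ℂ[x]` on `ℂ[x]`. -/
def mulOp : ℂ[X] →ₐ[ℂ] Module.End ℂ ℂ[X] := Algebra.lmul ℂ ℂ[X]

@[simp] theorem L_monomial (k : ℕ) (c : ℂ) :
    L (monomial k c) = monomial (k + 1) (((k : ℂ) + 1)⁻¹ * c) := by
  simp [L, Polynomial.lsum_apply, Polynomial.smul_monomial]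

theorem D_mul_L : D * L = 1 := by
  apply Polynomial.lhom_ext'
  intro k
  ext1
  have : (k : ℂ) + 1 ≠ 0 := Nat.cast_add_one_ne_zero k
  simp [D, this]

theorem L_mul_D_apply (p : ℂ[X]) : L (D p) = p - C (p.coeff 0) := by
  induction p using Polynomial.induction_on' with
  | add p q hp hq => simp only [map_add, hp, hq, coeff_add]; abel
  | monomial k c =>
    rcases k with _ | k
    · simp [D]
    · have : (k : ℂ) + 1 ≠ 0 := Nat.cast_add_one_ne_zero k
      simp [D, coeff_monomial]
      field_simp

theorem weylOp : D * mulOp X - mulOp X * D = 1 := by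
  refine LinearMap.ext fun p => ?_
  simp [D, mulOp]

theorem L_mul_D_sub_one_mem : L * D - 1 ∈ finiteRankIdeal ℂ ℂ[X] := by
  have h : LinearMap.range (L * D - 1) ≤ Submodule.span ℂ {(1 : ℂ[X])} := by
    rintro _ ⟨p, rfl⟩
    rw [Submodule.mem_span_singleton]
    refine ⟨-p.coeff 0, ?_⟩
    simp [L_mul_D_apply, Polynomial.smul_eq_C_mul]
  exact Submodule.finiteDimensional_of_le h

/-- The homomorphism `θ : ℂ[x]⟨∂, ∂⁻¹⟩ → M_ℂ(ℂ[x])` extending the natural action of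
`ℂ[x]⟨∂⟩` on `ℂ[x]`; it sends `∂⁻¹` to the inverse of the class of `D`, the class of `L`. -/
def theta : PsiDO →ₐ[ℂ] CalkinAlgebra ℂ ℂ[X] :=
  PsiDO.lift (Ideal.Quotient.mk _ (mulOp X)) (Ideal.Quotient.mk _ D) (Ideal.Quotient.mk _ L)
    (by rw [← map_mul, ← map_mul, ← map_sub, weylOp, map_one])
    (by rw [← map_mul, D_mul_L, map_one])
    (by
      rw [← map_mul, ← map_one (Ideal.Quotient.mk (finiteRankIdeal ℂ ℂ[X])), Ideal.Quotient.eq]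
      exact L_mul_D_sub_one_mem)

namespace PsiDO

theorem eq_top_of_mem (S : Subalgebra ℂ PsiDO) (hx : x ∈ S) (hd : del ∈ S) (he : delInv ∈ S)
    (P : PsiDO) : P ∈ S := by
  obtain ⟨p, rfl⟩ := mk_surjective P
  have h : (⊤ : Subalgebra ℂ (FreeAlgebra ℂ PsiGen)) ≤ S.comap mk := by
    rw [← FreeAlgebra.adjoin_range_ι, Algebra.adjoin_le_iff]
    rintro _ ⟨i, rfl⟩
    cases i
    · exact hx
    · exact hd
    · exact he
  exact h (Algebra.mem_top (x := p))

theorem del_mul_ofPoly (a : ℂ[X]) : del * ofPoly a = ofPoly a * del + ofPoly (D a) := by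
  induction a using Polynomial.induction_on with
  | C c => simp [D, ofPoly, Algebra.commutes]
  | add p q hp hq => simp only [map_add, mul_add, add_mul, hp, hq]; abel
  | monomial n c ih =>
    have hx : ofPoly X = x := by simp [ofPoly]
    have hD : D (C c * X ^ (n + 1)) = D (C c * X ^ n) * X + C c * X ^ n := by
      rw [pow_succ, ← mul_assoc]; simp only [D, derivative_mul, derivative_X, mul_one]
    have hw : del * x = x * del + 1 := by rw [← weyl]; abel
    rw [hD, pow_succ, ← mul_assoc, map_mul ofPoly _ X, ← mul_assoc, ih, map_add ofPoly,
      map_mul ofPoly _ X, hx, add_mul, mul_assoc _ del, hw, mul_add, mul_one]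
    simp only [← mul_assoc]
    abel

theorem delInv_mul_ofPoly_mul_del (a : ℂ[X]) :
    delInv * ofPoly a * del = ofPoly a - delInv * ofPoly (D a) := by
  have h : ofPoly a * del = del * ofPoly a - ofPoly (D a) := by rw [del_mul_ofPoly]; abel
  rw [mul_assoc, h, mul_sub, ← mul_assoc, delInv_del, one_mul]

/-- The elements `a∂^i` and `b∂⁻¹c` with `a, b, c ∈ ℂ[x]`. -/
def normalElements : Set PsiDO :=
  {P | (∃ a i, P = ofPoly a * del ^ i) ∨ ∃ b c, P = ofPoly b * delInv * ofPoly c}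

theorem span_normalElements (P : PsiDO) : P ∈ Submodule.span ℂ normalElements := by
  set S := Submodule.span ℂ normalElements with hS
  have h₁ (a : ℂ[X]) (i : ℕ) : ofPoly a * del ^ i ∈ S := Submodule.subset_span (.inl ⟨a, i, rfl⟩)
  have h₂ (b c : ℂ[X]) : ofPoly b * delInv * ofPoly c ∈ S :=
    Submodule.subset_span (.inr ⟨b, c, rfl⟩)
  have h₃ (c : ℂ[X]) : delInv * ofPoly c ∈ S := by simpa using h₂ 1 c
  have h₄ (i : ℕ) : ∀ a, delInv * (ofPoly a * del ^ i) ∈ S := by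
    induction i with
    | zero => intro a; simpa using h₃ a
    | succ i ih =>
      intro a
      have : delInv * (ofPoly a * del ^ (i + 1)) =
          ofPoly a * del ^ i - delInv * (ofPoly (D a) * del ^ i) := by
        rw [pow_succ', ← mul_assoc, ← mul_assoc, delInv_mul_ofPoly_mul_del, sub_mul, mul_assoc]
      rw [this]
      exact S.sub_mem (h₁ a i) (ih _)
  have key (g : PsiDO) (h : ∀ Q ∈ normalElements, g * Q ∈ S) : ∀ Q ∈ S, g * Q ∈ S := by
    intro Q hQ
    induction hQ using Submodule.span_induction with
    | mem Q hQ => exact h Q hQ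
    | zero => simp
    | add _ _ _ _ h h' => rw [mul_add]; exact S.add_mem h h'
    | smul c _ _ h => rw [mul_smul_comm]; exact S.smul_mem c h
  let T : Subalgebra ℂ PsiDO :=
    { carrier := {P | ∀ Q ∈ S, P * Q ∈ S}
      mul_mem' := fun {a b} ha hb Q hQ => by rw [mul_assoc]; exact ha _ (hb _ hQ)
      add_mem' := fun {a b} ha hb Q hQ => by rw [add_mul]; exact S.add_mem (ha _ hQ) (hb _ hQ)
      algebraMap_mem' := fun c Q hQ => by
        rw [← Algebra.smul_def]; exact S.smul_mem c hQ }
  have hx : ofPoly X = x := by simp [ofPoly]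
  have hT : P ∈ T := by
    apply eq_top_of_mem T
    · apply key
      rintro _ (⟨a, i, rfl⟩ | ⟨b, c, rfl⟩)
      · rw [← hx, ← mul_assoc, ← map_mul]; exact h₁ _ _
      · rw [← hx, ← mul_assoc, ← mul_assoc, ← map_mul]; exact h₂ _ _
    · apply key
      rintro _ (⟨a, i, rfl⟩ | ⟨b, c, rfl⟩)
      · rw [← mul_assoc, del_mul_ofPoly, add_mul, mul_assoc, ← pow_succ']
        exact S.add_mem (h₁ _ _) (h₁ _ _)
      · rw [← mul_assoc, ← mul_assoc, del_mul_ofPoly, add_mul, add_mul, mul_assoc (ofPoly b),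
          del_delInv, mul_one, ← map_mul]
        exact S.add_mem (by simpa using h₁ (b * c) 0) (h₂ _ _)
    · apply key
      rintro _ (⟨a, i, rfl⟩ | ⟨b, c, rfl⟩)
      · exact h₄ i a
      · have hb : ofPoly b = del * ofPoly (L b) - ofPoly (L b) * del := by
          have : D (L b) = b := by
            have := LinearMap.congr_fun D_mul_L b
            simpa using this
          rw [del_mul_ofPoly, this]; abel
        have : delInv * (ofPoly b * delInv * ofPoly c) =
            ofPoly (L b) * delInv * ofPoly c - delInv * ofPoly (L b * c) := by
          calc delInv * (ofPoly b * delInv * ofPoly c)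
              = (delInv * del) * ofPoly (L b) * delInv * ofPoly c
                - delInv * ofPoly (L b) * (del * delInv) * ofPoly c := by
                rw [hb]; simp only [mul_sub, sub_mul, mul_assoc]
            _ = _ := by rw [delInv_del, del_delInv, map_mul]; simp only [mul_one, one_mul, mul_assoc]
        rw [this]
        exact S.sub_mem (h₂ _ _) (h₃ _)
  have h1 : (1 : PsiDO) ∈ S := by simpa using h₁ 1 0
  simpa using hT 1 h1

end PsiDO

/-- The prescription `α(∑ aᵢ∂^i + ∑ bⱼ∂⁻¹cⱼ) = ∑ aᵢD^i + ∑ bⱼLcⱼ` for a linear map `α`. -/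
structure IsNormalLift (α : PsiDO →ₗ[ℂ] Module.End ℂ ℂ[X]) : Prop where
  diff : ∀ (a : ℂ[X]) (i : ℕ), α (PsiDO.ofPoly a * PsiDO.del ^ i) = mulOp a * D ^ i
  int : ∀ b c : ℂ[X], α (PsiDO.ofPoly b * PsiDO.delInv * PsiDO.ofPoly c) = mulOp b * L * mulOp c

theorem IsNormalLift.unique {α β : PsiDO →ₗ[ℂ] Module.End ℂ ℂ[X]} (hα : IsNormalLift α)
    (hβ : IsNormalLift β) : α = β := by
  ext1 P
  induction PsiDO.span_normalElements P using Submodule.span_induction with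
  | mem Q hQ =>
    rcases hQ with ⟨a, i, rfl⟩ | ⟨b, c, rfl⟩
    · rw [hα.diff, hβ.diff]
    · rw [hα.int, hβ.int]
  | zero => simp
  | add _ _ _ _ h h' => rw [map_add, map_add, h, h']
  | smul c _ _ h => rw [map_smul, map_smul, h]

/-! An auxiliary module on which `∂` acts bijectively, used to construct the normal lift: it has
a basis `e_k = x^k / k!`, `k ∈ ℤ`. -/
namespace Model

def del : Module.End ℂ (ℤ →₀ ℂ) := Finsupp.lmapDomain ℂ ℂ fun k => k - 1
def delInv : Module.End ℂ (ℤ →₀ ℂ) := Finsupp.lmapDomain ℂ ℂ fun k => k + 1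
def x : Module.End ℂ (ℤ →₀ ℂ) :=
  Finsupp.lsum ℂ fun k : ℤ => ((k : ℂ) + 1) • Finsupp.lsingle (k + 1)
def incl : ℂ[X] →ₗ[ℂ] (ℤ →₀ ℂ) := Polynomial.lsum fun k => (k ! : ℂ) • Finsupp.lsingle (k : ℤ)
def proj : (ℤ →₀ ℂ) →ₗ[ℂ] ℂ[X] :=
  Finsupp.lsum ℂ fun k : ℤ => if 0 ≤ k then (k.toNat ! : ℂ)⁻¹ • Polynomial.monomial k.toNat else 0

def rho : PsiDO →ₐ[ℂ] Module.End ℂ (ℤ →₀ ℂ) :=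
  PsiDO.lift x del delInv
    (by
      apply Finsupp.lhom_ext; intro k c
      simp [x, del, -Finsupp.single_mul, -Finsupp.single_add, ← Finsupp.single_sub]; ring_nf)
    (by apply Finsupp.lhom_ext; intro k c; simp [del, delInv])
    (by apply Finsupp.lhom_ext; intro k c; simp [del, delInv])

theorem proj_del : proj ∘ₗ del = D ∘ₗ proj := by
  apply Finsupp.lhom_ext; intro k c
  rcases lt_or_ge k 0 with hk | hk
  · simp [proj, del, D, not_le.2 hk, show ¬ (1 ≤ k) by omega]
  · lift k to ℕ using hk
    rcases k with _ | k
    · simp [proj, del, D]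
    · have : ((k : ℂ) + 1) ≠ 0 := Nat.cast_add_one_ne_zero k
      simp [proj, del, D, Nat.factorial_succ, smul_monomial, show (0 : ℤ) ≤ (k : ℤ) + 1 by omega,
        show ((k : ℤ) + 1).toNat = k + 1 by omega]
      field_simp

theorem proj_x : proj ∘ₗ x = mulOp X ∘ₗ proj := by
  apply Finsupp.lhom_ext; intro k c
  rcases lt_or_ge k 0 with hk | hk
  · rcases eq_or_ne k (-1) with rfl | hk'
    · simp [proj, x]
    · simp [proj, x, -Finsupp.single_mul, -Finsupp.single_add, not_le.2 hk, show ¬ (0 ≤ k + 1) by omega]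
  · lift k to ℕ using hk
    have : ((k : ℂ) + 1) ≠ 0 := Nat.cast_add_one_ne_zero k
    simp [proj, x, mulOp, -Finsupp.single_mul, -Finsupp.single_add, Nat.factorial_succ, smul_monomial, show (0 : ℤ) ≤ (k : ℤ) + 1 by omega,
        show ((k : ℤ) + 1).toNat = k + 1 by omega, X_mul_monomial]
    field_simp

theorem delInv_incl : delInv ∘ₗ incl = incl ∘ₗ L := by
  apply Polynomial.lhom_ext'; intro k; ext1
  have : ((k : ℂ) + 1) ≠ 0 := Nat.cast_add_one_ne_zero k
  simp [delInv, incl, -Finsupp.single_mul, -Finsupp.single_add, Polynomial.lsum_apply, Nat.factorial_succ]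
  field_simp

theorem x_incl : x ∘ₗ incl = incl ∘ₗ mulOp X := by
  apply Polynomial.lhom_ext'; intro k; ext1
  simp [x, incl, mulOp, -Finsupp.single_mul, -Finsupp.single_add, Polynomial.lsum_apply, Nat.factorial_succ, X_mul_monomial, mul_comm]

theorem proj_incl : proj ∘ₗ incl = LinearMap.id := by
  apply Polynomial.lhom_ext'; intro k; ext1
  have : (k ! : ℂ) ≠ 0 := Nat.cast_ne_zero.2 (Nat.factorial_ne_zero k)
  simp [proj, incl, -Finsupp.single_mul, -Finsupp.single_add, Polynomial.lsum_apply, smul_monomial, this]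

theorem proj_ofPoly (a : ℂ[X]) : proj ∘ₗ rho (PsiDO.ofPoly a) = mulOp a ∘ₗ proj := by
  induction a using Polynomial.induction_on with
  | C c => refine LinearMap.ext fun w => ?_; simp [PsiDO.ofPoly, mulOp, ← Polynomial.smul_eq_C_mul]
  | add p q hp hq => simp only [map_add, LinearMap.comp_add, LinearMap.add_comp, hp, hq]
  | monomial n c ih =>
    have hx : rho (PsiDO.ofPoly X) = x := by simp [PsiDO.ofPoly, rho]
    rw [pow_succ, ← mul_assoc, map_mul, map_mul, map_mul mulOp, hx, Module.End.mul_eq_comp,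
      Module.End.mul_eq_comp, ← LinearMap.comp_assoc, ih, LinearMap.comp_assoc, proj_x,
      LinearMap.comp_assoc]

theorem ofPoly_incl (a : ℂ[X]) : rho (PsiDO.ofPoly a) ∘ₗ incl = incl ∘ₗ mulOp a := by
  induction a using Polynomial.induction_on with
  | C c => refine LinearMap.ext fun w => ?_; simp [PsiDO.ofPoly, mulOp, ← Polynomial.smul_eq_C_mul]
  | add p q hp hq => simp only [map_add, LinearMap.comp_add, LinearMap.add_comp, hp, hq]
  | monomial n c ih =>
    have hx : rho (PsiDO.ofPoly X) = x := by simp [PsiDO.ofPoly, rho]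
    rw [pow_succ, ← mul_assoc, map_mul, map_mul, map_mul mulOp, hx, Module.End.mul_eq_comp,
      Module.End.mul_eq_comp, LinearMap.comp_assoc, x_incl, ← LinearMap.comp_assoc, ih,
      LinearMap.comp_assoc]

theorem proj_del_pow (i : ℕ) : proj ∘ₗ (del ^ i) = (D ^ i) ∘ₗ proj := by
  induction i with
  | zero => rfl
  | succ i ih =>
    rw [pow_succ, pow_succ, Module.End.mul_eq_comp, Module.End.mul_eq_comp, ← LinearMap.comp_assoc,
      ih, LinearMap.comp_assoc, proj_del, LinearMap.comp_assoc]

end Model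

theorem exists_isNormalLift : ∃ α, IsNormalLift α := by
  let α : PsiDO →ₗ[ℂ] Module.End ℂ ℂ[X] :=
    { toFun := fun P => Model.proj ∘ₗ Model.rho P ∘ₗ Model.incl
      map_add' := fun P Q => by refine LinearMap.ext fun w => ?_; simp
      map_smul' := fun c P => by refine LinearMap.ext fun w => ?_; simp }
  refine ⟨α, fun a i => ?_, fun b c => ?_⟩
  · change Model.proj ∘ₗ Model.rho _ ∘ₗ Model.incl = _
    have : Model.rho PsiDO.del = Model.del := by simp [Model.rho]
    rw [map_mul, map_pow, this, Module.End.mul_eq_comp, ← LinearMap.comp_assoc,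
      ← LinearMap.comp_assoc, Model.proj_ofPoly, LinearMap.comp_assoc _ Model.proj,
      Model.proj_del_pow, LinearMap.comp_assoc, LinearMap.comp_assoc, Model.proj_incl]
    rfl
  · change Model.proj ∘ₗ Model.rho _ ∘ₗ Model.incl = _
    have : Model.rho PsiDO.delInv = Model.delInv := by simp [Model.rho]
    rw [map_mul, map_mul, this, Module.End.mul_eq_comp, Module.End.mul_eq_comp,
      LinearMap.comp_assoc, Model.ofPoly_incl, LinearMap.comp_assoc,
      ← LinearMap.comp_assoc _ Model.incl, Model.delInv_incl, ← LinearMap.comp_assoc,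
      Model.proj_ofPoly, LinearMap.comp_assoc, LinearMap.comp_assoc,
      ← LinearMap.comp_assoc _ Model.incl, Model.proj_incl]
    rfl

/-- The linear map `α₀ : ℂ[x]⟨∂, ∂⁻¹⟩ → End(ℂ[x])`, the unique one with
`α₀(∑ aᵢ∂^i + ∑ bⱼ∂⁻¹cⱼ) = ∑ aᵢD^i + ∑ bⱼLcⱼ`. -/
def alphaZero : PsiDO →ₗ[ℂ] Module.End ℂ ℂ[X] := exists_isNormalLift.choose

theorem isNormalLift_alphaZero : IsNormalLift alphaZero := exists_isNormalLift.choose_spec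

theorem mk_mulOp (a : ℂ[X]) : Ideal.Quotient.mk (finiteRankIdeal ℂ ℂ[X]) (mulOp a) =
    theta (PsiDO.ofPoly a) := by
  induction a using Polynomial.induction_on with
  | C c =>
    have : mulOp (C c) = algebraMap ℂ _ c := mulOp.commutes c
    rw [this, PsiDO.ofPoly, aeval_C, AlgHom.commutes]; rfl
  | add p q hp hq => simp only [map_add, hp, hq]
  | monomial n c ih =>
    rw [pow_succ, ← mul_assoc, map_mul mulOp, map_mul, ih, map_mul PsiDO.ofPoly _ X, map_mul theta]
    simp [PsiDO.ofPoly, theta]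

theorem mk_alphaZero (P : PsiDO) :
    Ideal.Quotient.mk (finiteRankIdeal ℂ ℂ[X]) (alphaZero P) = theta P := by
  have hd : theta PsiDO.del = Ideal.Quotient.mk _ D := by simp [theta]
  have he : theta PsiDO.delInv = Ideal.Quotient.mk _ L := by simp [theta]
  induction PsiDO.span_normalElements P using Submodule.span_induction with
  | mem Q hQ =>
    rcases hQ with ⟨a, i, rfl⟩ | ⟨b, c, rfl⟩
    · rw [isNormalLift_alphaZero.diff, map_mul, map_mul, map_pow, map_pow, mk_mulOp, hd]
    · rw [isNormalLift_alphaZero.int, map_mul, map_mul, map_mul, map_mul, mk_mulOp, mk_mulOp, he]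
  | zero => simp
  | add _ _ _ _ h h' => simp only [map_add, h, h']
  | smul c Q _ h =>
    rw [map_smul, map_smul theta, ← h]; rfl

/-- The Calkin cocycle `σ₀ = σ_{α₀}` on `ℂ[x]⟨∂, ∂⁻¹⟩`. -/
def sigmaZero : PsiDO →ₗ[ℂ] PsiDO →ₗ[ℂ] ℂ := calkinCocycle theta alphaZero mk_alphaZero

/-! ### Differential operators on the circle -/

inductive CircleGen | z | zInv | dz

/-- The relations `(d/dz)z - z(d/dz) = 1`, `z z⁻¹ = 1`, `z⁻¹ z = 1`. -/
inductive CircleRel : FreeAlgebra ℂ CircleGen → FreeAlgebra ℂ CircleGen → Prop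
  | weyl : CircleRel (.ι ℂ .dz * .ι ℂ .z - .ι ℂ .z * .ι ℂ .dz) 1
  | z_zInv : CircleRel (.ι ℂ .z * .ι ℂ .zInv) 1
  | zInv_z : CircleRel (.ι ℂ .zInv * .ι ℂ .z) 1

/-- The algebra `ℂ[z, z⁻¹][d/dz]` of differential operators on the circle, presented by generators
and relations. It is a Lie algebra for the commutator. -/
def CircleDO : Type := RingQuot CircleRel

instance : Ring CircleDO := inferInstanceAs (Ring (RingQuot CircleRel))
instance : Algebra ℂ CircleDO := inferInstanceAs (Algebra ℂ (RingQuot CircleRel))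
instance : LieRing CircleDO := LieRing.ofAssociativeRing
instance : LieAlgebra ℂ CircleDO := LieAlgebra.ofAssociativeAlgebra

namespace CircleDO

/-- The quotient map from the free algebra. -/
def mk : FreeAlgebra ℂ CircleGen →ₐ[ℂ] CircleDO := RingQuot.mkAlgHom ℂ CircleRel

theorem mk_rel {a b : FreeAlgebra ℂ CircleGen} (h : CircleRel a b) : mk a = mk b :=
  RingQuot.mkAlgHom_rel ℂ h

theorem mk_surjective : Function.Surjective mk := RingQuot.mkAlgHom_surjective ℂ CircleRel

def z : CircleDO := mk (.ι ℂ .z)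
def zInv : CircleDO := mk (.ι ℂ .zInv)
def dz : CircleDO := mk (.ι ℂ .dz)

theorem weyl : dz * z - z * dz = 1 := by
  simpa [z, zInv, dz] using mk_rel CircleRel.weyl

theorem z_zInv : z * zInv = 1 := by
  simpa [z, zInv, dz] using mk_rel CircleRel.z_zInv

theorem zInv_z : zInv * z = 1 := by
  simpa [z, zInv, dz] using mk_rel CircleRel.zInv_z

/-- The universal property of the presentation. -/
def lift {B : Type*} [Ring B] [Algebra ℂ B] (u e d : B) (h₁ : d * u - u * d = 1)
    (h₂ : u * e = 1) (h₃ : e * u = 1) : CircleDO →ₐ[ℂ] B :=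
  show RingQuot _ →ₐ[ℂ] B from RingQuot.liftAlgHom ℂ
    ⟨FreeAlgebra.lift ℂ (fun i => match i with | .z => u | .zInv => e | .dz => d), by
      rintro _ _ (_ | _ | _) <;> simp [h₁, h₂, h₃]⟩

section
variable {B : Type*} [Ring B] [Algebra ℂ B] {u e d : B} (h₁ : d * u - u * d = 1)
    (h₂ : u * e = 1) (h₃ : e * u = 1)

@[simp] theorem lift_z : lift u e d h₁ h₂ h₃ z = u := by
  exact (RingQuot.liftAlgHom_mkAlgHom_apply ..).trans (by simp)
@[simp] theorem lift_zInv : lift u e d h₁ h₂ h₃ zInv = e := by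
  exact (RingQuot.liftAlgHom_mkAlgHom_apply ..).trans (by simp)
@[simp] theorem lift_dz : lift u e d h₁ h₂ h₃ dz = d := by
  exact (RingQuot.liftAlgHom_mkAlgHom_apply ..).trans (by simp)

theorem hom_ext {f g : CircleDO →ₐ[ℂ] B} (hz : f z = g z) (hi : f zInv = g zInv)
    (hd : f dz = g dz) : f = g := by
  apply RingQuot.ringQuot_ext'
  apply FreeAlgebra.hom_ext
  funext i
  cases i
  · exact hz
  · exact hi
  · exact hd

end

theorem eq_top_of_mem (S : Subalgebra ℂ CircleDO) (hz : z ∈ S) (hi : zInv ∈ S) (hd : dz ∈ S)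
    (P : CircleDO) : P ∈ S := by
  obtain ⟨p, rfl⟩ := mk_surjective P
  have h : (⊤ : Subalgebra ℂ (FreeAlgebra ℂ CircleGen)) ≤
      S.comap mk := by
    rw [← FreeAlgebra.adjoin_range_ι, Algebra.adjoin_le_iff]
    rintro _ ⟨i, rfl⟩
    cases i
    · exact hz
    · exact hi
    · exact hd
  exact h (Algebra.mem_top (x := p))

/-- `z` as a unit. -/
def zUnit : CircleDOˣ := ⟨z, zInv, z_zInv, zInv_z⟩

/-- The inclusion `ℂ[z, z⁻¹] → ℂ[z, z⁻¹][d/dz]`. -/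
def ofLaurent : ℂ[T;T⁻¹] →ₐ[ℂ] CircleDO :=
  AddMonoidAlgebra.lift ℂ CircleDO ℤ ((Units.coeHom CircleDO).comp (zpowersHom CircleDOˣ zUnit))

end CircleDO

/-- The isomorphism `g : ℂ[z, z⁻¹][d/dz] → ℂ[x]⟨∂, ∂⁻¹⟩` with `z ↦ ∂` and `d/dz ↦ -x`. -/
def circleEquiv : CircleDO ≃ₐ[ℂ] PsiDO :=
  AlgEquiv.ofAlgHom
    (CircleDO.lift PsiDO.del PsiDO.delInv (-PsiDO.x)
      (by rw [← PsiDO.weyl, neg_mul, mul_neg]; abel) PsiDO.del_delInv PsiDO.delInv_del)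
    (PsiDO.lift (-CircleDO.dz) CircleDO.z CircleDO.zInv
      (by rw [← CircleDO.weyl, neg_mul, mul_neg]; abel) CircleDO.z_zInv CircleDO.zInv_z)
    (by apply PsiDO.hom_ext <;> simp)
    (by apply CircleDO.hom_ext <;> simp)

/-- The cocycle `σ₁` on `ℂ[z, z⁻¹][d/dz]`: the transport of `σ₀` along `g`. -/
def sigmaOne : CircleDO →ₗ[ℂ] CircleDO →ₗ[ℂ] ℂ :=
  sigmaZero.compl₁₂ circleEquiv.toLinearMap circleEquiv.toLinearMap

/-- The derivative `d/dz` on Laurent polynomials, `z^k ↦ k z^(k-1)`. -/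
def laurentDeriv : Module.End ℂ ℂ[T;T⁻¹] :=
  (Finsupp.lsum ℂ fun k : ℤ =>
    (LinearMap.toSpanSingleton ℂ ℂ[T;T⁻¹] ((k : ℂ) • LaurentPolynomial.T (k - 1)))) ∘ₗ
    (AddMonoidAlgebra.coeffLinearEquiv ℂ).toLinearMap

/-- The residue at `z = 0`: the coefficient of `z⁻¹`. -/
def residue (f : ℂ[T;T⁻¹]) : ℂ := f.coeff (-1)

/-- The map `∑ fₙ Yⁿ ↦ ∑ fₙ (d/dz)^n`. -/
def symbolMap : ℂ[T;T⁻¹][X] →ₗ[ℂ] CircleDO :=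
  Polynomial.lsum fun n => LinearMap.mulRight ℂ (CircleDO.dz ^ n) ∘ₗ CircleDO.ofLaurent.toLinearMap

@[simp] theorem laurentDeriv_T (k : ℤ) :
    laurentDeriv (LaurentPolynomial.T k) = (k : ℂ) • LaurentPolynomial.T (k - 1) := by
  change (Finsupp.lsum ℂ fun k : ℤ => _) (Finsupp.single k (1 : ℂ)) = _
  rw [Finsupp.lsum_single, LinearMap.toSpanSingleton_apply, one_smul]

theorem laurent_hom_ext {M : Type*} [AddCommGroup M] [Module ℂ M] {f g : ℂ[T;T⁻¹] →ₗ[ℂ] M}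
    (h : ∀ k, f (LaurentPolynomial.T k) = g (LaurentPolynomial.T k)) : f = g := by
  refine LinearMap.ext fun p => ?_
  induction p using LaurentPolynomial.induction_on' with
  | add p q hp hq => rw [map_add, map_add, hp, hq]
  | C_mul_T k c => rw [← LaurentPolynomial.smul_eq_C_mul, map_smul, map_smul, h]

theorem laurentDeriv_T_mul (k : ℤ) (p : ℂ[T;T⁻¹]) :
    laurentDeriv (LaurentPolynomial.T k * p) =
      (k : ℂ) • (LaurentPolynomial.T (k - 1) * p) + LaurentPolynomial.T k * laurentDeriv p := by
  have := laurent_hom_ext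
    (f := laurentDeriv ∘ₗ LinearMap.mulLeft ℂ (LaurentPolynomial.T k))
    (g := (k : ℂ) • LinearMap.mulLeft ℂ (LaurentPolynomial.T (k - 1)) +
      LinearMap.mulLeft ℂ (LaurentPolynomial.T k) ∘ₗ laurentDeriv) (fun m => by
        simp only [LinearMap.comp_apply, LinearMap.mulLeft_apply, LinearMap.add_apply,
          LinearMap.smul_apply, laurentDeriv_T, mul_smul_comm, ← LaurentPolynomial.T_add]
        rw [show k - 1 + m = k + m - 1 by ring, show k + (m - 1) = k + m - 1 by ring, ← add_smul,
          Int.cast_add])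
  exact LinearMap.congr_fun this p

namespace CircleDO

theorem ofLaurent_T (k : ℤ) :
    ofLaurent (LaurentPolynomial.T k) = ((zUnit ^ k : CircleDOˣ) : CircleDO) := by
  unfold ofLaurent LaurentPolynomial.T
  rw [AddMonoidAlgebra.lift_single, one_smul]
  rfl

theorem ofLaurent_T_one : ofLaurent (LaurentPolynomial.T 1) = z := by
  rw [ofLaurent_T, zpow_one]; rfl

theorem ofLaurent_T_neg_one : ofLaurent (LaurentPolynomial.T (-1)) = zInv := by
  rw [ofLaurent_T, zpow_neg_one]; rfl

/-- The action of differential operators on Laurent polynomials. -/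
def action : CircleDO →ₐ[ℂ] Module.End ℂ ℂ[T;T⁻¹] :=
  lift (LinearMap.mulLeft ℂ (LaurentPolynomial.T 1)) (LinearMap.mulLeft ℂ (LaurentPolynomial.T (-1)))
    laurentDeriv
    (by
      refine LinearMap.ext fun p => ?_
      change laurentDeriv (LaurentPolynomial.T 1 * p) - LaurentPolynomial.T 1 * laurentDeriv p = p
      rw [laurentDeriv_T_mul]
      simp)
    (by
      refine LinearMap.ext fun p => ?_
      change LaurentPolynomial.T 1 * (LaurentPolynomial.T (-1) * p) = p
      rw [← mul_assoc, ← LaurentPolynomial.T_add]; simp)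
    (by
      refine LinearMap.ext fun p => ?_
      change LaurentPolynomial.T (-1) * (LaurentPolynomial.T 1 * p) = p
      rw [← mul_assoc, ← LaurentPolynomial.T_add]; simp)

theorem action_ofLaurent (f p : ℂ[T;T⁻¹]) : action (ofLaurent f) p = f * p := by
  have h : action.comp ofLaurent = Algebra.lmul ℂ ℂ[T;T⁻¹] := by
    have hT : ∀ k : ℤ, action (ofLaurent (LaurentPolynomial.T k)) =
        Algebra.lmul ℂ _ (LaurentPolynomial.T k) := by
      have h1 : action (ofLaurent (LaurentPolynomial.T 1)) =
          Algebra.lmul ℂ _ (LaurentPolynomial.T 1) := by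
        rw [ofLaurent_T_one]; simp [action]; rfl
      have h2 : action (ofLaurent (LaurentPolynomial.T (-1))) =
          Algebra.lmul ℂ _ (LaurentPolynomial.T (-1)) := by
        rw [ofLaurent_T_neg_one]; simp [action]; rfl
      intro k
      induction k using Int.induction_on with
      | zero => rw [LaurentPolynomial.T_zero, map_one, map_one, map_one]
      | succ n ih => simp only [LaurentPolynomial.T_add, map_mul, ih, h1]
      | pred n ih => simp only [sub_eq_add_neg, LaurentPolynomial.T_add, map_mul, ih, h2]
    have := laurent_hom_ext (f := (action.comp ofLaurent).toLinearMap)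
      (g := (Algebra.lmul ℂ ℂ[T;T⁻¹]).toLinearMap) (fun k => by simpa using hT k)
    exact AlgHom.toLinearMap_injective this
  exact LinearMap.congr_fun (DFunLike.congr_fun h f) p

theorem dz_mul_ofLaurent (f : ℂ[T;T⁻¹]) :
    dz * ofLaurent f = ofLaurent f * dz + ofLaurent (laurentDeriv f) := by
  have hz : dz * z = z * dz + 1 := by rw [← weyl]; abel
  have hi : dz * zInv = zInv * dz - zInv * zInv := by
    calc dz * zInv = zInv * (z * dz) * zInv := by rw [← mul_assoc, zInv_z, one_mul]
      _ = zInv * (dz * z - 1) * zInv := by rw [hz]; simp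
      _ = zInv * dz * (z * zInv) - zInv * zInv := by
        simp only [mul_sub, sub_mul, mul_assoc, mul_one]
      _ = _ := by rw [z_zInv, mul_one]
  have hT : ∀ k : ℤ, dz * ofLaurent (LaurentPolynomial.T k) = ofLaurent (LaurentPolynomial.T k) * dz
      + ofLaurent (laurentDeriv (LaurentPolynomial.T k)) := by
    intro k
    induction k using Int.induction_on with
    | zero => rw [laurentDeriv_T]; simp
    | succ n ih =>
      rw [add_comm, LaurentPolynomial.T_add, laurentDeriv_T_mul 1, map_mul, map_add, map_smul, map_mul _ _ (laurentDeriv _),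
        map_mul _ _ (LaurentPolynomial.T (n : ℤ)), ofLaurent_T_one, ← mul_assoc, hz, add_mul, mul_assoc z dz, ih]
      simp only [mul_add, ← mul_assoc, one_mul, sub_self, Int.cast_one, one_smul,
        LaurentPolynomial.T_zero, map_one]
      abel
    | pred n ih =>
      rw [sub_eq_add_neg, add_comm, LaurentPolynomial.T_add, laurentDeriv_T_mul (-1), map_mul,
        map_add, map_mul _ _ (laurentDeriv _), map_smul, map_mul _ _ (LaurentPolynomial.T (-n)),
        ofLaurent_T_neg_one, ← mul_assoc, hi, sub_mul, mul_assoc zInv dz, ih,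
        show (-1 - 1 : ℤ) = -1 + -1 by norm_num, LaurentPolynomial.T_add, map_mul,
        ofLaurent_T_neg_one]
      simp only [mul_add, ← mul_assoc, Int.cast_neg, Int.cast_one, neg_smul]
      rw [one_smul]; abel
  have := laurent_hom_ext (f := LinearMap.mulLeft ℂ dz ∘ₗ ofLaurent.toLinearMap)
    (g := LinearMap.mulRight ℂ dz ∘ₗ ofLaurent.toLinearMap + ofLaurent.toLinearMap ∘ₗ laurentDeriv)
    (fun k => by simpa using hT k)
  exact LinearMap.congr_fun this f

end CircleDO

@[simp] theorem symbolMap_monomial (n : ℕ) (f : ℂ[T;T⁻¹]) :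
    symbolMap (monomial n f) = CircleDO.ofLaurent f * CircleDO.dz ^ n := by
  simp [symbolMap, Polynomial.lsum_apply]

theorem symbolMap_surjective : Function.Surjective symbolMap := by
  intro P
  set S := LinearMap.range symbolMap with hS
  have h₁ (f : ℂ[T;T⁻¹]) (n : ℕ) : CircleDO.ofLaurent f * CircleDO.dz ^ n ∈ S :=
    ⟨monomial n f, symbolMap_monomial n f⟩
  have key (g : CircleDO) (h : ∀ f n, g * (CircleDO.ofLaurent f * CircleDO.dz ^ n) ∈ S) :
      ∀ Q ∈ S, g * Q ∈ S := by
    rintro _ ⟨p, rfl⟩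
    induction p using Polynomial.induction_on' with
    | add p q hp hq => rw [map_add, mul_add]; exact S.add_mem hp hq
    | monomial n f => rw [symbolMap_monomial]; exact h f n
  let T : Subalgebra ℂ CircleDO :=
    { carrier := {P | ∀ Q ∈ S, P * Q ∈ S}
      mul_mem' := fun {a b} ha hb Q hQ => by rw [mul_assoc]; exact ha _ (hb _ hQ)
      add_mem' := fun {a b} ha hb Q hQ => by rw [add_mul]; exact S.add_mem (ha _ hQ) (hb _ hQ)
      algebraMap_mem' := fun c Q hQ => by
        rw [← Algebra.smul_def]; exact S.smul_mem c hQ }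
  have hT : P ∈ T := by
    apply CircleDO.eq_top_of_mem T
    · apply key
      intro f n
      rw [← CircleDO.ofLaurent_T_one, ← mul_assoc, ← map_mul]; exact h₁ _ _
    · apply key
      intro f n
      rw [← CircleDO.ofLaurent_T_neg_one, ← mul_assoc, ← map_mul]; exact h₁ _ _
    · apply key
      intro f n
      rw [← mul_assoc, CircleDO.dz_mul_ofLaurent, add_mul, mul_assoc, ← pow_succ']
      exact S.add_mem (h₁ _ _) (h₁ _ _)
  have h1 : (1 : CircleDO) ∈ S := by simpa using h₁ 1 0
  have : P * 1 ∈ S := hT 1 h1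
  rwa [mul_one] at this

theorem laurentDeriv_pow_T (m n : ℕ) : (laurentDeriv ^ m) (LaurentPolynomial.T (n : ℤ)) =
    (n.descFactorial m : ℂ) • LaurentPolynomial.T ((n : ℤ) - m) := by
  induction m with
  | zero => simp
  | succ m ih =>
    rw [pow_succ', Module.End.mul_apply, ih, map_smul, laurentDeriv_T, smul_smul,
      Nat.descFactorial_succ, show (n : ℤ) - (m + 1 : ℕ) = n - m - 1 by push_cast; ring]
    congr 1
    rcases le_or_gt m n with h | h
    · push_cast [Nat.cast_sub h]; ring
    · simp [Nat.descFactorial_eq_zero_iff_lt.2 h]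

theorem symbolMap_injective : Function.Injective symbolMap := by
  rw [← LinearMap.ker_eq_bot, LinearMap.ker_eq_bot']
  intro p hp
  have hact : CircleDO.action CircleDO.dz = laurentDeriv := by simp [CircleDO.action]
  have h (n : ℕ) : (p.sum fun m f => f * (n.descFactorial m : ℂ) •
      (LaurentPolynomial.T ((n : ℤ) - m) : ℂ[T;T⁻¹])) = 0 := by
    have := congrArg (fun P => CircleDO.action P (LaurentPolynomial.T (n : ℤ))) hp
    simp only [map_zero, LinearMap.zero_apply] at this
    rw [← this]
    simp only [symbolMap, Polynomial.lsum_apply, Polynomial.sum_def, map_sum, LinearMap.sum_apply]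
    refine Finset.sum_congr rfl fun m _ => ?_
    simp [hact, CircleDO.action_ofLaurent, laurentDeriv_pow_T]
  ext1 n
  induction n using Nat.strong_induction_on with
  | _ n ih =>
    have hn := h n
    rw [Polynomial.sum_def, Finset.sum_eq_single n] at hn
    · have h0 : (n ! : ℂ) ≠ 0 := Nat.cast_ne_zero.2 (Nat.factorial_ne_zero n)
      simpa [Nat.descFactorial_self, h0] using hn
    · intro m _ hm
      rcases lt_or_gt_of_ne hm with h | h
      · rw [ih m h]; simp
      · simp [Nat.descFactorial_eq_zero_iff_lt.2 h]
    · intro hm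
      rw [notMem_support_iff.1 hm, zero_mul]

/-- Every differential operator `P` on the circle has a unique expression `P = ∑ fₙ (d/dz)^n` with
`fₙ ∈ ℂ[z, z⁻¹]`; `symbol P = ∑ fₙ Yⁿ` records its coefficients. -/
def symbol : CircleDO ≃ₗ[ℂ] ℂ[T;T⁻¹][X] :=
  (LinearEquiv.ofBijective symbolMap ⟨symbolMap_injective, symbolMap_surjective⟩).symm

/-- The Kac cocycle `τ` on `ℂ[z, z⁻¹][d/dz]`, the bilinear form with
`τ(f (d/dz)^n, g (d/dz)^s) = n! s! / (n + s + 1)! · Res_{z = 0} f^{(s)} g^{(n+1)} dz`.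
Its sign is normalised by `τ(z, z⁻¹) = -1`. The opposite form
`-τ(f (d/dz)^n, g (d/dz)^s) = n! s! / (n + s + 1)! · Res_{z = 0} f^{(s+1)} g^{(n)} dz` is also in
use; it is the same cocycle for the opposite choice of generator of the centre. -/
def kacCocycle (P Q : CircleDO) : ℂ :=
  (symbol P).sum fun n f => (symbol Q).sum fun s g =>
    ((n ! * s ! : ℕ) : ℂ) / ((n + s + 1)! : ℂ) *
      residue ((laurentDeriv ^ s) f * (laurentDeriv ^ (n + 1)) g)

theorem kacCocycle_apply (f g : ℂ[T;T⁻¹]) (n s : ℕ) :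
    kacCocycle (CircleDO.ofLaurent f * CircleDO.dz ^ n) (CircleDO.ofLaurent g * CircleDO.dz ^ s) =
      ((n ! * s ! : ℕ) : ℂ) / ((n + s + 1)! : ℂ) *
        residue ((laurentDeriv ^ s) f * (laurentDeriv ^ (n + 1)) g) := by
  have h (f : ℂ[T;T⁻¹]) (n : ℕ) :
      symbol (CircleDO.ofLaurent f * CircleDO.dz ^ n) = monomial n f := by
    rw [← symbolMap_monomial]
    exact LinearEquiv.symm_apply_apply (LinearEquiv.ofBijective symbolMap _) _
  rw [kacCocycle, h, h, Polynomial.sum_monomial_index, Polynomial.sum_monomial_index]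
  · simp [residue]
  · simp [Polynomial.sum_def, residue]

end CalkinKac

end

/-! Let `ρ` (`Model.rho`) be the representation of `ℂ[x]⟨∂, ∂⁻¹⟩` on the space with basis `e_k =
x^k/k!`, `k ∈ ℤ`, on which `∂` is invertible. The lift `α₀` is the compression of `ρ` to the span of
the `e_k` with `k ≥ 0` (`alphaZero_apply`). Since `ρ` is multiplicative, the defect `α₀([P, Q]) -
[α₀(P), α₀(Q)]` only records what passes through negative indices: apply one operator to some `e_i`
with `i ≥ 0`, land below `0`, and come back with the other.

Under `g`, the operator `z^a (d/dz)^n` acts on the model as a weighted shift by `n - a`, with a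
falling factorial as weight (`Model.rho_single`). So for two such operators the defect has trace
zero unless the shifts are opposite, `d` and `-d`. In that case the trace is, up to sign, a sum over
`0 ≤ i < |d|` of products of two falling factorials (`sigmaZero_of_shift`). A Vandermonde-type
convolution of binomial coefficients (`sum_range_choose_mul_choose`) evaluates it, and the result is
the residue formula for `τ`. Bilinearity does the rest.

The cocycle property holds for every lift of a homomorphism to the Calkin algebra: it follows from
the Jacobi identity in both algebras and from the vanishing of the trace on commutators with one
finite-rank entry (`finiteRankTrace_lie`). -/

noncomputable section

namespace CalkinKac

/-! ### The finite-rank trace and the cocycle property of the Calkin cocycle -/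

section Calkin

variable {K V : Type*} [Field K] [AddCommGroup V] [Module K V]

/-- The definition uses the range of the operator itself, which is awkward for products and for
explicit computation. Any finite-dimensional subspace containing the range serves as well. -/
theorem finiteRankTrace_eq_trace_restrict (f : finiteRankIdeal K V) (q : Submodule K V)
    [FiniteDimensional K q] (hf : ∀ x, f.1 x ∈ q) :
    finiteRankTrace K V f = LinearMap.trace K q (f.1.restrict fun x _ => hf x) := by
  refine trace_restrict_eq f.1 (LinearMap.range f.1) q ?_ (fun x => LinearMap.mem_range_self f.1 x)
  rintro _ ⟨x, rfl⟩
  exact hf x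

/-- The trace of a finite-rank operator is invariant under cyclic permutation of its factors, one
of which need not have finite rank. -/
theorem finiteRankTrace_mul_comm (f : finiteRankIdeal K V) (b : Module.End K V) :
    finiteRankTrace K V ⟨f.1 * b, (finiteRankIdeal K V).mul_mem_right b f.2⟩ =
      finiteRankTrace K V ⟨b * f.1, (finiteRankIdeal K V).mul_mem_left b f.2⟩ := by
  have : FiniteDimensional K (LinearMap.range f.1) := f.2
  set W := LinearMap.range f.1 with hW
  -- `f * b` has values in `W` and `b * f` has values in `U`. As `b` maps `W` to `U` and `f` maps
  -- `U` to `W`, cyclicity of the trace for maps between two finite-dimensional spaces applies.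
  set U := W.map b with hU
  rw [finiteRankTrace_eq_trace_restrict _ W fun x => ⟨b x, rfl⟩,
    finiteRankTrace_eq_trace_restrict _ U fun x => ⟨f.1 x, ⟨x, rfl⟩, rfl⟩]
  exact LinearMap.trace_comp_comm' (b.restrict (p := W) (q := U) fun x hx => ⟨x, hx, rfl⟩)
    (f.1.restrict (p := U) (q := W) fun x _ => ⟨x, rfl⟩)

theorem lie_mem_finiteRankIdeal (f : finiteRankIdeal K V) (b : Module.End K V) :
    ⁅f.1, b⁆ ∈ finiteRankIdeal K V :=
  Submodule.sub_mem _ ((finiteRankIdeal K V).mul_mem_right b f.2)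
    ((finiteRankIdeal K V).mul_mem_left b f.2)

theorem finiteRankTrace_lie (f : finiteRankIdeal K V) (b : Module.End K V) :
    finiteRankTrace K V ⟨⁅f.1, b⁆, lie_mem_finiteRankIdeal f b⟩ = 0 := by
  have h : (⟨⁅f.1, b⁆, lie_mem_finiteRankIdeal f b⟩ : finiteRankIdeal K V) =
      ⟨f.1 * b, (finiteRankIdeal K V).mul_mem_right b f.2⟩ -
        ⟨b * f.1, (finiteRankIdeal K V).mul_mem_left b f.2⟩ := Subtype.ext (Ring.lie_def f.1 b)
  rw [h, map_sub, finiteRankTrace_mul_comm, sub_self]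

variable {A : Type*} [Ring A] [Algebra K A]

theorem lift_lie_sub_mem {θ : A →ₐ[K] CalkinAlgebra K V} {α : A →ₗ[K] Module.End K V}
    (hα : ∀ P, Ideal.Quotient.mk (finiteRankIdeal K V) (α P) = θ P) (P Q : A) :
    α ⁅P, Q⁆ - ⁅α P, α Q⁆ ∈ finiteRankIdeal K V := by
  rw [← Ideal.Quotient.eq_zero_iff_mem]
  simp only [map_sub, Ring.lie_def, map_mul, hα, sub_self]

theorem calkinCocycle_apply {θ : A →ₐ[K] CalkinAlgebra K V} {α : A →ₗ[K] Module.End K V}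
    (hα : ∀ P, Ideal.Quotient.mk (finiteRankIdeal K V) (α P) = θ P) (P Q : A) :
    calkinCocycle θ α hα P Q =
      finiteRankTrace K V ⟨α ⁅P, Q⁆ - ⁅α P, α Q⁆, lift_lie_sub_mem hα P Q⟩ := rfl

theorem calkinCocycle_self {θ : A →ₐ[K] CalkinAlgebra K V} {α : A →ₗ[K] Module.End K V}
    (hα : ∀ P, Ideal.Quotient.mk (finiteRankIdeal K V) (α P) = θ P) (P : A) :
    calkinCocycle θ α hα P P = 0 := by
  rw [calkinCocycle_apply, ← map_zero (finiteRankTrace K V)]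
  congr 1
  ext1
  simp [Ring.lie_def]

/-- With `F` the defect of `α` as a Lie homomorphism, the cyclic sum of `F([P, Q], R) + [F(P, Q), α
R]` vanishes: the terms `[α [P, Q], α R]` cancel, leaving `α` of a Jacobi sum minus a Jacobi sum in
`End V`. The brackets `[F(P, Q), α R]` are killed by the trace. -/
theorem calkinCocycle_jacobi {θ : A →ₐ[K] CalkinAlgebra K V} {α : A →ₗ[K] Module.End K V}
    (hα : ∀ P, Ideal.Quotient.mk (finiteRankIdeal K V) (α P) = θ P) (P Q R : A) :
    calkinCocycle θ α hα ⁅P, Q⁆ R + calkinCocycle θ α hα ⁅Q, R⁆ P +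
      calkinCocycle θ α hα ⁅R, P⁆ Q = 0 := by
  let F (P Q : A) : finiteRankIdeal K V := ⟨α ⁅P, Q⁆ - ⁅α P, α Q⁆, lift_lie_sub_mem hα P Q⟩
  let G (P Q R : A) : finiteRankIdeal K V :=
    ⟨⁅(F P Q).1, α R⁆, lie_mem_finiteRankIdeal (F P Q) (α R)⟩
  have hG (P Q R : A) : finiteRankTrace K V (G P Q R) = 0 := finiteRankTrace_lie _ _
  have h : F ⁅P, Q⁆ R + F ⁅Q, R⁆ P + F ⁅R, P⁆ Q + (G P Q R + G Q R P + G R P Q) = 0 := by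
    ext1
    have hJ : α ⁅⁅P, Q⁆, R⁆ + α ⁅⁅Q, R⁆, P⁆ + α ⁅⁅R, P⁆, Q⁆ = 0 := by
      rw [← map_add, ← map_add, ← map_zero α]
      congr 1
      simp only [Ring.lie_def]
      noncomm_ring
    change (α ⁅⁅P, Q⁆, R⁆ - ⁅α ⁅P, Q⁆, α R⁆ + (α ⁅⁅Q, R⁆, P⁆ - ⁅α ⁅Q, R⁆, α P⁆) +
      (α ⁅⁅R, P⁆, Q⁆ - ⁅α ⁅R, P⁆, α Q⁆)) + (⁅α ⁅P, Q⁆ - ⁅α P, α Q⁆, α R⁆ +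
      ⁅α ⁅Q, R⁆ - ⁅α Q, α R⁆, α P⁆ + ⁅α ⁅R, P⁆ - ⁅α R, α P⁆, α Q⁆) = 0
    -- Once the values of `α` are atoms and `hJ` has eliminated `x₁`, what remains is an identity in
    -- a free noncommutative ring.
    generalize α ⁅⁅P, Q⁆, R⁆ = x₁, α ⁅⁅Q, R⁆, P⁆ = x₂, α ⁅⁅R, P⁆, Q⁆ = x₃,
      α ⁅P, Q⁆ = y₁, α ⁅Q, R⁆ = y₂, α ⁅R, P⁆ = y₃, α P = p, α Q = q, α R = r at hJ ⊢
    rw [add_assoc, add_eq_zero_iff_eq_neg] at hJ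
    subst hJ
    simp only [Ring.lie_def]
    noncomm_ring
  have h' := congrArg (finiteRankTrace K V) h
  simp only [map_add, hG, add_zero, map_zero] at h'
  exact h'

end Calkin

/-! ### The trace on polynomials, and the cocycle property of `sigmaOne` -/

/-- The trace of an operator on polynomials with values in degree `< N` is computed on the
monomials of degree `< N`. -/
theorem finiteRankTrace_eq_sum_coeff {K : Type*} [Field K] (f : finiteRankIdeal K K[X]) (N : ℕ)
    (hf : ∀ k, f.1 (X ^ k) ∈ degreeLT K N) :
    finiteRankTrace K K[X] f = ∑ i ∈ Finset.range N, (f.1 (X ^ i)).coeff i := by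
  have hf' (p : K[X]) : f.1 p ∈ degreeLT K N := by
    induction p using Polynomial.induction_on' with
    | add p q hp hq => rw [map_add]; exact Submodule.add_mem _ hp hq
    | monomial n a =>
      rw [← mul_one a, ← smul_eq_mul, ← smul_monomial, map_smul, ← X_pow_eq_monomial]
      exact Submodule.smul_mem _ _ (hf n)
  have : FiniteDimensional K (degreeLT K N) := Module.Finite.of_basis (degreeLT.basis K N)
  rw [finiteRankTrace_eq_trace_restrict f _ hf',
    LinearMap.trace_eq_matrix_trace K (degreeLT.basis K N), Matrix.trace, Finset.sum_range]
  refine Finset.sum_congr rfl fun i _ => ?_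
  rw [Matrix.diag_apply, LinearMap.toMatrix_apply, degreeLT.basis_repr]
  simp

theorem isLieTwoCocycle_sigmaOne : IsLieTwoCocycle sigmaOne := by
  have h (P Q : CircleDO) : circleEquiv ⁅P, Q⁆ = ⁅circleEquiv P, circleEquiv Q⁆ := by
    simp only [Ring.lie_def, map_sub, map_mul]
  refine ⟨fun P => calkinCocycle_self mk_alphaZero _, fun P Q R => ?_⟩
  change sigmaZero (circleEquiv ⁅P, Q⁆) (circleEquiv R) +
    sigmaZero (circleEquiv ⁅Q, R⁆) (circleEquiv P) +
    sigmaZero (circleEquiv ⁅R, P⁆) (circleEquiv Q) = 0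
  rw [h, h, h]
  exact calkinCocycle_jacobi mk_alphaZero _ _ _

/-! ### The binomial convolution in terms of falling factorials -/

/-- Sort the subsets of `{0, …, d + s - 1}` with `n + s + 1` elements by their element of rank `s +
1`. If it is `i + s`, then `s` elements lie among the `i + s` smaller numbers and `n` among the `d -
1 - i` larger ones. The formal proof uses Pascal's rule on the second factor instead. -/
theorem sum_range_choose_mul_choose (d n s : ℕ) :
    ∑ i ∈ Finset.range d, (i + s).choose s * (d - 1 - i).choose n = (d + s).choose (n + s + 1) := by
  induction d generalizing n with
  | zero => simp [Nat.choose_eq_zero_of_lt]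
  | succ d ih =>
    rcases n with _ | n
    · have := ih 0
      simp only [Nat.choose_zero_right, mul_one, zero_add] at this ⊢
      rw [Finset.sum_range_succ, this, show d + 1 + s = d + s + 1 by ring, Nat.choose_succ_succ,
        add_comm]
    · rw [Finset.sum_range_succ, show d + 1 + s = d + s + 1 by ring, Nat.choose_succ_succ,
        show n + 1 + s = n + s + 1 by ring, ← ih n, show (n + s + 1).succ = n + 1 + s + 1 by omega,
        ← ih (n + 1), ← Finset.sum_add_distrib]
      -- The top term `i = d` vanishes because its second factor is `0` choose `n + 1`. For `i < d`
      -- the truncated subtraction `d - 1 - i` is exact, so Pascal's rule applies.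
      simp only [Nat.add_sub_cancel, Nat.sub_self, Nat.choose_zero_succ, mul_zero, add_zero]
      refine Finset.sum_congr rfl fun i hi => ?_
      rw [← mul_add, ← Nat.choose_succ_succ]
      congr 2
      have := Finset.mem_range.1 hi
      omega

theorem descPochhammer_eval_neg {R : Type*} [CommRing R] (s : ℕ) (y : R) :
    (descPochhammer R s).eval (-y) = (-1) ^ s * (descPochhammer R s).eval (y + s - 1) := by
  rw [descPochhammer_eval_eq_ascPochhammer, ← ascPochhammer_eval_neg_eq_descPochhammer]
  congr 1
  ring

theorem descPochhammer_eval_natCast (k n : ℕ) :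
    (descPochhammer ℂ k).eval (n : ℂ) = k ! * n.choose k := by
  rw [descPochhammer_eval_eq_descFactorial, Nat.descFactorial_eq_factorial_mul_choose,
    Nat.cast_mul]

/-- The left side is the trace of the defect for shifts `d` and `-d`, and the right side is the Kac
formula at exponents `n - d` and `s + d`. Reflection of falling factorials turns the left into the
binomial convolution times `(-1)^s n! s!`. On the right it makes the two factors concatenate to one
falling factorial of length `n + s + 1` at `d + s`. -/
theorem sum_range_descPochhammer_mul (d n s : ℕ) :
    ∑ i ∈ Finset.range d, (descPochhammer ℂ s).eval (-(i : ℂ) - 1) *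
        (descPochhammer ℂ n).eval ((d : ℂ) - i - 1) =
      ((n ! * s ! : ℕ) : ℂ) / ((n + s + 1)! : ℂ) *
        ((descPochhammer ℂ s).eval ((n : ℂ) - d) *
          (descPochhammer ℂ (n + 1)).eval ((s : ℂ) + d)) := by
  have h₁ : ∀ i ∈ Finset.range d, (descPochhammer ℂ s).eval (-(i : ℂ) - 1) *
      (descPochhammer ℂ n).eval ((d : ℂ) - i - 1) =
      (-1) ^ s * ((n ! * s ! : ℕ) : ℂ) * (((i + s).choose s * (d - 1 - i).choose n : ℕ) : ℂ) := by
    intro i hi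
    have hi := Finset.mem_range.1 hi
    rw [show -(i : ℂ) - 1 = -((i : ℂ) + 1) by ring, descPochhammer_eval_neg,
      show (i : ℂ) + 1 + s - 1 = ((i + s : ℕ) : ℂ) by push_cast; ring,
      show (d : ℂ) - i - 1 = ((d - 1 - i : ℕ) : ℂ) by
        rw [Nat.sub_sub, Nat.cast_sub (by omega)]; push_cast; ring,
      descPochhammer_eval_natCast, descPochhammer_eval_natCast]
    push_cast
    ring
  have h₂ : (descPochhammer ℂ s).eval ((n : ℂ) - d) * (descPochhammer ℂ (n + 1)).eval ((s : ℂ) + d)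
      = (-1) ^ s * ((n + s + 1)! * (d + s).choose (n + s + 1)) := by
    rw [show (n : ℂ) - d = -(d - n) by ring, descPochhammer_eval_neg,
      ← descPochhammer_eval_natCast, show n + s + 1 = (n + 1) + s by ring, ← descPochhammer_mul ℂ (n + 1) s,
      eval_mul, eval_comp]
    simp only [eval_sub, eval_X, eval_natCast]
    push_cast
    rw [show (d : ℂ) - n + s - 1 = d + s - (n + 1) by ring, add_comm (s : ℂ)]
    ring
  have h₃ : ((n + s + 1)! : ℂ) ≠ 0 := Nat.cast_ne_zero.2 (Nat.factorial_ne_zero _)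
  rw [Finset.sum_congr rfl h₁, ← Finset.mul_sum, ← Nat.cast_sum, sum_range_choose_mul_choose, h₂]
  field_simp

/-! ### The model: `α₀` as a compression and operators as weighted shifts -/

/-- The compression of the model action to `ℂ[x]`. -/
theorem alphaZero_apply (P : PsiDO) (p : ℂ[X]) :
    alphaZero P p = Model.proj (Model.rho P (Model.incl p)) := by
  let α : PsiDO →ₗ[ℂ] Module.End ℂ ℂ[X] :=
    { toFun := fun P => Model.proj ∘ₗ Model.rho P ∘ₗ Model.incl
      map_add' := fun P Q => by refine LinearMap.ext fun w => ?_; simp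
      map_smul' := fun c P => by refine LinearMap.ext fun w => ?_; simp }
  have hα : IsNormalLift α := by
    refine ⟨fun a i => LinearMap.ext fun p => ?_, fun b c => LinearMap.ext fun p => ?_⟩
    · have hd : Model.rho PsiDO.del = Model.del := by simp [Model.rho]
      have h₁ := LinearMap.congr_fun (Model.proj_ofPoly a) ((Model.del ^ i) (Model.incl p))
      have h₂ := LinearMap.congr_fun (Model.proj_del_pow i) (Model.incl p)
      have h₃ := LinearMap.congr_fun Model.proj_incl p
      simp only [LinearMap.comp_apply, LinearMap.id_apply] at h₁ h₂ h₃
      simp only [α, LinearMap.coe_mk, AddHom.coe_mk, LinearMap.comp_apply, map_mul, map_pow, hd,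
        Module.End.mul_apply, h₁, h₂, h₃]
    · have hd : Model.rho PsiDO.delInv = Model.delInv := by simp [Model.rho]
      have h₁ := LinearMap.congr_fun (Model.proj_ofPoly b) (Model.incl (L (mulOp c p)))
      have h₂ := LinearMap.congr_fun Model.delInv_incl (mulOp c p)
      have h₃ := LinearMap.congr_fun (Model.ofPoly_incl c) p
      have h₄ := LinearMap.congr_fun Model.proj_incl (L (mulOp c p))
      simp only [LinearMap.comp_apply, LinearMap.id_apply] at h₁ h₂ h₃ h₄
      simp only [α, LinearMap.coe_mk, AddHom.coe_mk, LinearMap.comp_apply, map_mul, hd,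
        Module.End.mul_apply, h₁, h₂, h₃, h₄]
  -- `alphaZero` is obtained by choice from an existence statement, so its formula is accessible
  -- only through uniqueness of the normal lift.
  rw [isNormalLift_alphaZero.unique hα]
  rfl

namespace Model

theorem incl_X_pow (k : ℕ) : incl (X ^ k) = (k ! : ℂ) • Finsupp.single (k : ℤ) 1 := by
  rw [X_pow_eq_monomial]
  simp [incl, Polynomial.lsum_apply, -Finsupp.single_mul]

theorem proj_single_natCast (k : ℕ) :
    proj (Finsupp.single (k : ℤ) 1) = (k ! : ℂ)⁻¹ • X ^ k := by
  simp [proj, X_pow_eq_monomial]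

theorem proj_single_of_neg {k : ℤ} (hk : k < 0) : proj (Finsupp.single k 1) = 0 := by
  simp [proj, not_le.2 hk]

/-- The truncation to `k ≥ 0` differs from the identity exactly on negative indices, and this
difference is the sole source of the cocycle. -/
theorem incl_proj_single (k : ℤ) : incl (proj (Finsupp.single k 1)) =
    if 0 ≤ k then Finsupp.single k 1 else 0 := by
  split_ifs with hk
  · lift k to ℕ using hk
    rw [proj_single_natCast, map_smul, incl_X_pow, smul_smul,
      inv_mul_cancel₀ (Nat.cast_ne_zero.2 (Nat.factorial_ne_zero k)), one_smul]
  · rw [proj_single_of_neg (not_le.1 hk), map_zero]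

theorem rho_del_zpow_single (a k : ℤ) :
    rho (circleEquiv (CircleDO.ofLaurent (LaurentPolynomial.T a))) (Finsupp.single k 1) =
      Finsupp.single (k - a) 1 := by
  induction a using Int.induction_on generalizing k with
  | zero => simp
  | succ n ih =>
    rw [LaurentPolynomial.T_add, map_mul, map_mul, map_mul, Module.End.mul_apply,
      CircleDO.ofLaurent_T_one]
    have : rho (circleEquiv CircleDO.z) (Finsupp.single k 1) = Finsupp.single (k - 1) 1 := by
      simp [rho, circleEquiv, del]
    rw [this, ih]
    congr 1
    ring
  | pred n ih =>
    rw [sub_eq_add_neg (-(n : ℤ)), LaurentPolynomial.T_add, map_mul, map_mul, map_mul,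
      Module.End.mul_apply, CircleDO.ofLaurent_T_neg_one]
    have : rho (circleEquiv CircleDO.zInv) (Finsupp.single k 1) = Finsupp.single (k + 1) 1 := by
      simp [rho, circleEquiv, delInv]
    rw [this, ih]
    congr 1
    ring

/-- Since `-x e_k = -(k + 1) e_{k+1}`, the vector `e_k` behaves like `z^(-k-1)` under `d/dz`, hence
the falling factorial at `-k - 1`. -/
theorem rho_dz_pow_single (n : ℕ) (k : ℤ) :
    rho (circleEquiv (CircleDO.dz ^ n)) (Finsupp.single k 1) =
      (descPochhammer ℂ n).eval (-(k : ℂ) - 1) • Finsupp.single (k + n) 1 := by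
  induction n with
  | zero => simp
  | succ n ih =>
    have : rho (circleEquiv CircleDO.dz) (Finsupp.single (k + n) 1) =
        (-(k : ℂ) - 1 - n) • Finsupp.single (k + n + 1) 1 := by
      simp [rho, circleEquiv, x, -Finsupp.single_mul, -Finsupp.single_add, -Finsupp.single_sub, -Finsupp.single_neg, ← Finsupp.single_neg]
      ring_nf
    rw [pow_succ', map_mul, map_mul, Module.End.mul_apply, ih, map_smul, this, smul_smul,
      descPochhammer_succ_eval]
    push_cast
    rw [add_assoc]

/-- The matrix coefficients of `z^a (d/dz)^n` in the basis `e_k` of the model. -/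
theorem rho_single (a : ℤ) (n : ℕ) (k : ℤ) :
    rho (circleEquiv (CircleDO.ofLaurent (LaurentPolynomial.T a) * CircleDO.dz ^ n))
        (Finsupp.single k 1) =
      (descPochhammer ℂ n).eval (-(k : ℂ) - 1) • Finsupp.single (k + (n - a)) 1 := by
  rw [map_mul, map_mul, Module.End.mul_apply, rho_dz_pow_single, map_smul, rho_del_zpow_single,
    add_sub_assoc]

end Model

/-! ### The Kac cocycle on monomials and its bilinearity -/

theorem laurentDeriv_pow_T_eq (s : ℕ) (a : ℤ) :
    (laurentDeriv ^ s) (LaurentPolynomial.T a) =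
      (descPochhammer ℂ s).eval (a : ℂ) • LaurentPolynomial.T (a - s) := by
  induction s with
  | zero => simp
  | succ s ih =>
    rw [pow_succ', Module.End.mul_apply, ih, map_smul, laurentDeriv_T, smul_smul,
      descPochhammer_succ_eval]
    push_cast
    rw [sub_sub]

theorem residue_T (a : ℤ) : residue (LaurentPolynomial.T a) = if a = -1 then 1 else 0 := by
  rw [residue]
  exact Finsupp.single_apply

/-- The residue selects `(a - s) + (b - n - 1) = -1`, which says that the shifts `n - a` and `s - b`
of the model action are opposite. -/
theorem kacCocycle_T (a b : ℤ) (n s : ℕ) :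
    kacCocycle (CircleDO.ofLaurent (LaurentPolynomial.T a) * CircleDO.dz ^ n)
        (CircleDO.ofLaurent (LaurentPolynomial.T b) * CircleDO.dz ^ s) =
      if a + b = n + s then ((n ! * s ! : ℕ) : ℂ) / ((n + s + 1)! : ℂ) *
        ((descPochhammer ℂ s).eval (a : ℂ) * (descPochhammer ℂ (n + 1)).eval (b : ℂ)) else 0 := by
  have h (c : ℂ) (f : ℂ[T;T⁻¹]) : residue (c • f) = c * residue f := by simp [residue]
  rw [kacCocycle_apply, laurentDeriv_pow_T_eq, laurentDeriv_pow_T_eq, smul_mul_smul_comm,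
    ← LaurentPolynomial.T_add, h, residue_T]
  have : a - s + (b - (n + 1 : ℕ)) = -1 ↔ a + b = n + s := by push_cast; omega
  simp only [this]
  split_ifs <;> simp

/-- `kacCocycle` is a bare function, so the reduction to monomials needs additivity in each argument
and, in `kacCocycle_smul_T`, homogeneity on monomials. -/
theorem kacCocycle_add_left (P P' Q : CircleDO) :
    kacCocycle (P + P') Q = kacCocycle P Q + kacCocycle P' Q := by
  unfold kacCocycle
  rw [map_add, Polynomial.sum_add_index]
  · intro n; simp [Polynomial.sum_def, residue]
  · intro n f g
    simp only [Polynomial.sum_def, ← Finset.sum_add_distrib]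
    refine Finset.sum_congr rfl fun s _ => ?_
    simp [residue, add_mul, mul_add]

theorem kacCocycle_add_right (P Q Q' : CircleDO) :
    kacCocycle P (Q + Q') = kacCocycle P Q + kacCocycle P Q' := by
  unfold kacCocycle
  rw [Polynomial.sum_def, Polynomial.sum_def, Polynomial.sum_def, ← Finset.sum_add_distrib]
  refine Finset.sum_congr rfl fun n _ => ?_
  rw [map_add, Polynomial.sum_add_index]
  · intro s; simp [residue]
  · intro s f g; simp [residue, mul_add]

theorem kacCocycle_smul_T (c c' : ℂ) (a b : ℤ) (n s : ℕ) :
    kacCocycle (c • (CircleDO.ofLaurent (LaurentPolynomial.T a) * CircleDO.dz ^ n))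
        (c' • (CircleDO.ofLaurent (LaurentPolynomial.T b) * CircleDO.dz ^ s)) =
      c * (c' * kacCocycle (CircleDO.ofLaurent (LaurentPolynomial.T a) * CircleDO.dz ^ n)
        (CircleDO.ofLaurent (LaurentPolynomial.T b) * CircleDO.dz ^ s)) := by
  rw [← smul_mul_assoc, ← smul_mul_assoc, ← map_smul, ← map_smul, kacCocycle_apply,
    kacCocycle_apply, map_smul, map_smul, smul_mul_smul_comm]
  simp [residue]
  ring

/-! ### Computing the Calkin cocycle on weighted shifts and comparing with `τ` -/

/-- The Calkin cocycle on two operators acting on the basis of the model by weighted shifts. -/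
theorem sigmaZero_of_shift {P Q : PsiDO} {c c' : ℤ → ℂ} {d d' : ℤ}
    (hP : ∀ k, Model.rho P (Finsupp.single k 1) = c k • Finsupp.single (k + d) 1)
    (hQ : ∀ k, Model.rho Q (Finsupp.single k 1) = c' k • Finsupp.single (k + d') 1) :
    sigmaZero P Q = ∑ i ∈ Finset.range (d.natAbs + d'.natAbs), if d + d' = 0 then
      (if (i : ℤ) + d' < 0 then c' i * c (i + d') else 0) -
        (if (i : ℤ) + d < 0 then c i * c' (i + d) else 0) else 0 := by
  -- Of `P Q` and `Q P` only the contributions whose intermediate index, `i + d'` or `i + d`, is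
  -- negative survive the subtraction of the compressed products.
  have hF (i : ℕ) : (alphaZero ⁅P, Q⁆ - ⁅alphaZero P, alphaZero Q⁆) (X ^ i) =
      (i ! * ((if (i : ℤ) + d' < 0 then c' i * c (i + d') else 0) -
        (if (i : ℤ) + d < 0 then c i * c' (i + d) else 0)) : ℂ) •
        Model.proj (Finsupp.single (i + (d + d')) 1) := by
    simp only [Ring.lie_def, map_sub, map_mul, LinearMap.sub_apply, Module.End.mul_apply,
      alphaZero_apply, Model.incl_X_pow, map_smul, hP, hQ, Model.incl_proj_single]
    rw [add_assoc, add_assoc, add_comm d' d]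
    rcases lt_or_ge ((i : ℤ) + d') 0 with h | h <;> rcases lt_or_ge ((i : ℤ) + d) 0 with h' | h' <;>
      simp only [h, h', not_le.2, not_lt.2, if_true, if_false, map_smul, map_zero, hP, hQ,
        add_assoc, add_comm d' d] <;> module
  have hdeg (i : ℕ) : (alphaZero ⁅P, Q⁆ - ⁅alphaZero P, alphaZero Q⁆) (X ^ i) ∈
      degreeLT ℂ (d.natAbs + d'.natAbs) := by
    rw [hF]
    rcases lt_or_ge ((i : ℤ) + (d + d')) 0 with h | h
    · rw [Model.proj_single_of_neg h, smul_zero]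
      exact Submodule.zero_mem _
    -- A surviving contribution has `i < -d'` or `i < -d`, so its degree `i + d + d'` is less than
    -- `d` or `d'`. This gives the bound `|d| + |d'|`.
    · by_cases hi : (i : ℤ) + d' < 0 ∨ (i : ℤ) + d < 0
      · obtain ⟨j, hj⟩ := Int.eq_ofNat_of_zero_le h
        rw [hj, Model.proj_single_natCast]
        refine Submodule.smul_mem _ _ (Submodule.smul_mem _ _ (mem_degreeLT.2 ?_))
        rw [degree_X_pow]
        exact_mod_cast (by omega : j < d.natAbs + d'.natAbs)
      · rw [not_or] at hi
        rw [if_neg hi.1, if_neg hi.2, sub_zero, mul_zero, zero_smul]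
        exact Submodule.zero_mem _
  refine (finiteRankTrace_eq_sum_coeff _ _ hdeg).trans (Finset.sum_congr rfl fun i _ => ?_)
  dsimp only
  rw [hF]
  by_cases h : d + d' = 0
  -- As `x^i = i! e_i`, the factor `i!` from `incl` cancels the `1/i!` from `proj`.
  · have hi : (i ! : ℂ) ≠ 0 := Nat.cast_ne_zero.2 (Nat.factorial_ne_zero i)
    rw [if_pos h, h, add_zero, Model.proj_single_natCast, coeff_smul, coeff_smul, coeff_X_pow_self,
      smul_eq_mul, smul_eq_mul]
    field_simp
  · rw [if_neg h]
    rcases lt_or_ge ((i : ℤ) + (d + d')) 0 with h₀ | h₀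
    · rw [Model.proj_single_of_neg h₀, smul_zero, coeff_zero]
    · obtain ⟨j, hj⟩ := Int.eq_ofNat_of_zero_le h₀
      rw [hj, Model.proj_single_natCast, coeff_smul, coeff_smul, coeff_X_pow,
        if_neg (show ¬ i = j by omega), smul_zero, smul_zero]

theorem sum_range_ite_lt {M : Type*} [AddCommMonoid M] {d N : ℕ} (h : d ≤ N) (f : ℕ → M) :
    (∑ i ∈ Finset.range N, if (i : ℤ) + -(d : ℤ) < 0 then f i else 0) =
      ∑ i ∈ Finset.range d, f i := by
  rw [← Finset.sum_filter]
  congr 1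
  ext i
  simp only [Finset.mem_filter, Finset.mem_range]
  omega

theorem sigmaOne_T (a b : ℤ) (n s : ℕ) :
    sigmaOne (CircleDO.ofLaurent (LaurentPolynomial.T a) * CircleDO.dz ^ n)
        (CircleDO.ofLaurent (LaurentPolynomial.T b) * CircleDO.dz ^ s) =
      kacCocycle (CircleDO.ofLaurent (LaurentPolynomial.T a) * CircleDO.dz ^ n)
        (CircleDO.ofLaurent (LaurentPolynomial.T b) * CircleDO.dz ^ s) := by
  refine (sigmaZero_of_shift (Model.rho_single a n) (Model.rho_single b s)).trans ?_
  rw [kacCocycle_T]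
  by_cases h : a + b = n + s
  · have h' : (n : ℤ) - a + (s - b) = 0 := by omega
    simp only [h, h', if_true]
    -- With opposite shifts only the lowering operator can take a nonnegative index below `0`, so
    -- one of the two sums disappears.
    rcases le_total 0 ((n : ℤ) - a) with hd | hd
    · obtain ⟨d, hd⟩ := Int.eq_ofNat_of_zero_le hd
      have hd' : (s : ℤ) - b = -d := by omega
      obtain rfl : a = n - d := by omega
      obtain rfl : b = s + d := by omega
      simp only [hd, hd']
      have h₁ : ∀ i : ℕ, ¬ (i : ℤ) + (d : ℤ) < 0 := by omega
      simp only [h₁, if_false, sub_zero]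
      rw [sum_range_ite_lt (by omega)]
      push_cast
      rw [← Nat.cast_mul, ← sum_range_descPochhammer_mul]
      refine Finset.sum_congr rfl fun i _ => ?_
      congr 2
      ring
    · obtain ⟨d, hd⟩ := Int.eq_ofNat_of_zero_le (neg_nonneg.2 hd)
      replace hd : (n : ℤ) - a = -d := by omega
      have hd' : (s : ℤ) - b = d := by omega
      obtain rfl : a = n + d := by omega
      obtain rfl : b = s - d := by omega
      simp only [hd, hd']
      have h₁ : ∀ i : ℕ, ¬ (i : ℤ) + (d : ℤ) < 0 := by omega
      simp only [h₁, if_false, zero_sub]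
      rw [Finset.sum_neg_distrib, sum_range_ite_lt (by omega)]
      -- The roles of the two operators are exchanged here. Splitting the last factor off the
      -- falling factorials of length `s + 1` and `n + 1` leaves `n + d - s` on one side and `s - d
      -- - n` on the other. These are opposite, which absorbs the minus sign of the second sum.
      have h₂ := sum_range_descPochhammer_mul d s n
      rw [descPochhammer_succ_eval] at h₂ ⊢
      push_cast at h₂ ⊢
      have h₃ : ∀ i ∈ Finset.range d, (descPochhammer ℂ n).eval (-(i : ℂ) - 1) *
          (descPochhammer ℂ s).eval (-((i : ℂ) + -d) - 1) =
          (descPochhammer ℂ n).eval (-(i : ℂ) - 1) * (descPochhammer ℂ s).eval ((d : ℂ) - i - 1) := by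
        intro i _
        congr 2
        ring
      rw [Finset.sum_congr rfl h₃, h₂, add_comm s n]
      ring
  · have h' : ¬ (n : ℤ) - a + (s - b) = 0 := by omega
    simp only [h, h', if_false, Finset.sum_const_zero]

theorem sigmaOne_eq_kacCocycle (P Q : CircleDO) : sigmaOne P Q = kacCocycle P Q := by
  obtain ⟨p, rfl⟩ := symbolMap_surjective P
  obtain ⟨q, rfl⟩ := symbolMap_surjective Q
  induction p using Polynomial.induction_on' with
  | add p p' hp hp' => rw [map_add, map_add, LinearMap.add_apply, kacCocycle_add_left, hp, hp']
  | monomial n f =>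
    induction q using Polynomial.induction_on' with
    | add q q' hq hq' => rw [map_add, map_add, kacCocycle_add_right, hq, hq']
    | monomial s g =>
      rw [symbolMap_monomial, symbolMap_monomial]
      induction f using LaurentPolynomial.induction_on' with
      | add f f' hf hf' =>
        rw [map_add, add_mul, map_add, LinearMap.add_apply, kacCocycle_add_left, hf, hf']
      | C_mul_T a c =>
        induction g using LaurentPolynomial.induction_on' with
        | add g g' hg hg' => rw [map_add, add_mul, map_add, kacCocycle_add_right, hg, hg']
        | C_mul_T b c' =>
          rw [← LaurentPolynomial.smul_eq_C_mul, ← LaurentPolynomial.smul_eq_C_mul, map_smul,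
            map_smul, smul_mul_assoc, smul_mul_assoc, kacCocycle_smul_T, map_smul, map_smul,
            LinearMap.smul_apply, smul_eq_mul, smul_eq_mul, sigmaOne_T]
          ring

end CalkinKac

end

theorem mainTheorem2 :
    CalkinKac.IsLieTwoCocycle CalkinKac.sigmaOne ∧
      ∀ P Q : CalkinKac.CircleDO, CalkinKac.sigmaOne P Q = CalkinKac.kacCocycle P Q :=
  ⟨CalkinKac.isLieTwoCocycle_sigmaOne, CalkinKac.sigmaOne_eq_kacCocycle⟩
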